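/- All objects are real and $C^\infty$. For a vector field $X$ on a manifold $M$ let $\mathrm{Aut}(X)$ be the group of diffeomorphisms $\varphi$ of $M$ with $\varphi_*X=X$. Given a smooth action of a Lie group $G$ on $M$, a vector field $X$ on $M$ is a \emph{describing vector field} for the action if 1. $X$ is complete and its flow $\Phi_t$ commutes with the action of $G$, and 2. the map $G\times\mathbb{R}\to\mathrm{Aut}(X)$, $(g,t)\mapsto g\circ\Phi_t$, is well defined and a group isomorphism. Let $H\le SO(3)$ be the Klein four-group consisting of the identity and the three rotations of angle $\pi$ around the coordinate axes, and let $k\ge 1$. Let $F$ be either the homogeneous space $SO(3)/H$, on which $SO(3)$ acts by $g\cdot\overline{g'}=\overline{gg'}$, or the unit sphere $S^2\subset\mathbb{R}^3$ with the usual action of $SO(3)$. Let $SO(3)$ act on $M=\mathbb{R}^k\times F$ by $g\cdot(x,y)=(x,g\cdot y)$. Then, in both cases: (a) this action is smooth and effective; (b) it has no describing vector field; (c) if $U$ is a vector field on $M$ that commutes with the action (that is, $g_*U=U$ for all $g\in SO(3)$), then there are smooth functions $f_1,\dots,f_k\colon\mathbb{R}^k\to\mathbb{R}$ with $U=\sum_{j=1}^k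 f_j(x)\,\partial/\partial x_j$, and for every diffeomorphism $\varphi\colon F\to F$ the diffeomorphism $(x,y)\mapsto(x,\varphi(y))$ of $M$ belongs to $\mathrm{Aut}(U)$. -/

import Mathlib

open scoped Manifold ContDiff Matrix

/-- The rotation group `SO(3)`, with the topology induced from the space of `3 × 3` matrices. -/
abbrev SO3 : Type := Matrix.specialOrthogonalGroup (Fin 3) ℝ

namespace SO3

theorem star_mul_self' (A : SO3) : A.1ᵀ * A.1 = 1 := by
  have := A.2.1.1
  rwa [Matrix.star_eq_conjTranspose] at this

theorem mul_star_self' (A : SO3) : A.1 * A.1ᵀ = 1 := by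
  have := A.2.1.2
  rwa [Matrix.star_eq_conjTranspose] at this

theorem det_eq (A : SO3) : A.1.det = 1 := A.2.2

theorem mem_of {A : Matrix (Fin 3) (Fin 3) ℝ} (h : A * Aᵀ = 1) (hd : A.det = 1) :
    A ∈ Matrix.specialOrthogonalGroup (Fin 3) ℝ := by
  refine ⟨Matrix.mem_unitaryGroup_iff.2 ?_, hd⟩
  exact h

theorem coe_inv (A : SO3) : (A⁻¹ : SO3).1 = A.1ᵀ := rfl

instance : IsTopologicalGroup SO3 where
  continuous_inv := by
    refine Continuous.subtype_mk ?_ _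
    exact continuous_subtype_val.matrix_transpose

/-- The rotation with Cayley parameter `v`. -/
noncomputable def cayleyMatrix (v : EuclideanSpace ℝ (Fin 3)) : Matrix (Fin 3) (Fin 3) ℝ :=
  (1 + v 0 ^ 2 + v 1 ^ 2 + v 2 ^ 2)⁻¹ •
    !![1 + v 0 ^ 2 - v 1 ^ 2 - v 2 ^ 2, 2 * (v 0 * v 1 - v 2), 2 * (v 0 * v 2 + v 1);
       2 * (v 0 * v 1 + v 2), 1 - v 0 ^ 2 + v 1 ^ 2 - v 2 ^ 2, 2 * (v 1 * v 2 - v 0);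
       2 * (v 0 * v 2 - v 1), 2 * (v 1 * v 2 + v 0), 1 - v 0 ^ 2 - v 1 ^ 2 + v 2 ^ 2]

theorem cayley_pos (v : EuclideanSpace ℝ (Fin 3)) : 1 + v 0 ^ 2 + v 1 ^ 2 + v 2 ^ 2 ≠ 0 := by
  positivity

theorem cayleyMatrix_mem (v : EuclideanSpace ℝ (Fin 3)) :
    cayleyMatrix v ∈ Matrix.specialOrthogonalGroup (Fin 3) ℝ := by
  have h := cayley_pos v
  apply mem_of
  · ext i j
    fin_cases i <;> fin_cases j <;>
      simp [cayleyMatrix, Matrix.mul_apply, Fin.sum_univ_three] <;> field_simp <;> ring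
  · simp [cayleyMatrix, Matrix.det_fin_three]
    field_simp
    ring

/-- The inverse of the Cayley parametrization. -/
noncomputable def cayleyCoord (A : SO3) : EuclideanSpace ℝ (Fin 3) :=
  (1 + A.1.trace)⁻¹ • !₂[A.1 2 1 - A.1 1 2, A.1 0 2 - A.1 2 0, A.1 1 0 - A.1 0 1]

theorem cayley_left_inv (A : SO3) (h : 1 + A.1.trace ≠ 0) :
    cayleyMatrix (cayleyCoord A) = A.1 := by
  have h1 := A.mul_star_self'
  have h2 := A.star_mul_self'
  have h3 := A.det_eq
  have h4 : A.1.adjugate = A.1ᵀ := by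
    have := Matrix.adjugate_mul A.1
    rw [h3, one_smul] at this
    calc A.1.adjugate = A.1.adjugate * (A.1 * A.1ᵀ) := by rw [h1, mul_one]
      _ = A.1ᵀ := by rw [← mul_assoc, this, one_mul]
  rw [Matrix.adjugate_fin_three] at h4
  obtain ⟨A, hA⟩ := A
  simp only [cayleyCoord] at *
  clear h3 hA
  simp only [← Matrix.ext_iff, Fin.forall_fin_succ, Matrix.mul_apply, Fin.sum_univ_three] at h1 h2 h4
  simp [Matrix.trace_fin_three] at h1 h2 h4 h
  have hs : ((1 + A.trace)⁻¹ * (A 2 1 - A 1 2))^2 + ((1 + A.trace)⁻¹ * (A 0 2 - A 2 0))^2 + ((1 + A.trace)⁻¹ * (A 1 0 - A 0 1))^2 = 4 * (1 + A.trace)⁻¹ - 1 := by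
    rw [Matrix.trace_fin_three]
    field_simp
    grind
  ext i j
  simp only [cayleyMatrix]
  simp
  have : 1 + ((1 + A.trace)⁻¹ * (A 2 1 - A 1 2))^2 + ((1 + A.trace)⁻¹ * (A 0 2 - A 2 0))^2 + ((1 + A.trace)⁻¹ * (A 1 0 - A 0 1))^2 = 4 * (1 + A.trace)⁻¹ := by linarith
  rw [this, Matrix.trace_fin_three]
  fin_cases i <;> fin_cases j <;> simp <;> field_simp <;> grind

theorem cayley_right_inv (v) :
    cayleyCoord ⟨cayleyMatrix v, cayleyMatrix_mem v⟩ = v := by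
  have h := cayley_pos v
  have : 1 + (cayleyMatrix v).trace = 4 * (1 + v 0 ^ 2 + v 1 ^ 2 + v 2 ^ 2)⁻¹ := by
    simp [cayleyMatrix, Matrix.trace_fin_three]
    field_simp
    ring
  ext i
  simp only [cayleyCoord, this]
  fin_cases i <;> simp [cayleyMatrix] <;> field_simp <;> ring

theorem continuous_entry (i j : Fin 3) : Continuous fun A : SO3 => A.1 i j :=
  continuous_subtype_val.matrix_elem i j

theorem contDiff_cayleyMatrix (n : ℕ∞ω) (i j : Fin 3) :
    ContDiff ℝ n fun v => cayleyMatrix v i j := by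
  have hc : ∀ k : Fin 3, ContDiff ℝ n fun v : EuclideanSpace ℝ (Fin 3) => v k := fun k =>
    (contDiff_piLp_apply (p := 2) (i := k))
  have h0 := hc 0
  have h1 := hc 1
  have h2 := hc 2
  have hi : ContDiff ℝ n fun v : EuclideanSpace ℝ (Fin 3) =>
      (1 + v 0 ^ 2 + v 1 ^ 2 + v 2 ^ 2)⁻¹ :=
    ContDiff.inv (by fun_prop) cayley_pos
  unfold cayleyMatrix
  fin_cases i <;> fin_cases j <;> simp <;> fun_prop

/-- The Cayley chart of `SO(3)` centred at the identity. -/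
noncomputable def cayleyChart : OpenPartialHomeomorph SO3 (EuclideanSpace ℝ (Fin 3)) where
  toFun := cayleyCoord
  invFun v := ⟨cayleyMatrix v, cayleyMatrix_mem v⟩
  source := {A | 1 + A.1.trace ≠ 0}
  target := Set.univ
  map_source' _ _ := Set.mem_univ _
  map_target' v _ := by
    have h := cayley_pos v
    have : 1 + (cayleyMatrix v).trace = 4 * (1 + v 0 ^ 2 + v 1 ^ 2 + v 2 ^ 2)⁻¹ := by
      simp [cayleyMatrix, Matrix.trace_fin_three]
      field_simp
      ring
    rw [Set.mem_ofPred_eq, this]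
    positivity
  left_inv' A h := Subtype.ext (cayley_left_inv A h)
  right_inv' v _ := cayley_right_inv v
  open_source := by
    refine isOpen_ne_fun ?_ continuous_const
    exact continuous_const.add continuous_subtype_val.matrix_trace
  open_target := isOpen_univ
  continuousOn_toFun := by
    refine ContinuousOn.smul (ContinuousOn.inv₀ (Continuous.continuousOn
      (continuous_const.add continuous_subtype_val.matrix_trace)) fun A h => h) ?_
    refine ((PiLp.continuous_toLp 2 _).comp (continuous_pi fun i => ?_)).continuousOn
    fin_cases i <;> exact (continuous_entry _ _).sub (continuous_entry _ _)
  continuousOn_invFun := by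
    refine (Continuous.subtype_mk (continuous_matrix fun i j => ?_) _).continuousOn
    exact (contDiff_cayleyMatrix 0 i j).continuous

/-- The Cayley chart of `SO(3)` centred at `A`. -/
noncomputable def chart (A : SO3) : OpenPartialHomeomorph SO3 (EuclideanSpace ℝ (Fin 3)) :=
  (Homeomorph.mulLeft A⁻¹).toOpenPartialHomeomorph ≫ₕ cayleyChart

theorem chart_apply (A B : SO3) : chart A B = cayleyCoord (A⁻¹ * B) := rfl

theorem chart_symm_apply (A : SO3) (v) :
    (chart A).symm v = A * ⟨cayleyMatrix v, cayleyMatrix_mem v⟩ := by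
  change A⁻¹⁻¹ * _ = _
  rw [inv_inv]
  rfl

theorem chart_source (A : SO3) : (chart A).source = {B | 1 + (A⁻¹ * B).1.trace ≠ 0} := by
  ext; simp [chart, cayleyChart]

/-- The smooth structure on `SO(3)` given by the Cayley charts. -/
noncomputable instance : ChartedSpace (EuclideanSpace ℝ (Fin 3)) SO3 where
  atlas := Set.range chart
  chartAt := chart
  mem_chart_source A := by
    rw [chart_source, Set.mem_ofPred_eq, inv_mul_cancel]
    simp
    norm_num
  chart_mem_atlas A := Set.mem_range_self A

theorem contDiffAt_cayleyCoord {E : Type*} [NormedAddCommGroup E] [NormedSpace ℝ E] {n : ℕ∞ω}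
    {f : E → SO3} {x : E} (hx : 1 + (f x).1.trace ≠ 0)
    (hf : ∀ i j, ContDiffAt ℝ n (fun y => (f y).1 i j) x) :
    ContDiffAt ℝ n (fun y => cayleyCoord (f y)) x := by
  have ht : ContDiffAt ℝ n (fun y => (1 + (f y).1.trace)⁻¹) x := by
    refine ContDiffAt.inv ?_ hx
    simp only [Matrix.trace_fin_three]
    exact contDiffAt_const.add (((hf 0 0).add (hf 1 1)).add (hf 2 2))
  refine ht.smul ?_
  rw [contDiffAt_piLp]
  intro i
  fin_cases i <;> exact (hf _ _).sub (hf _ _)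

theorem contDiffAt_mul_entry {E : Type*} [NormedAddCommGroup E] [NormedSpace ℝ E] {n : ℕ∞ω}
    {f : E → SO3} {x : E} (A : SO3) (hf : ∀ i j, ContDiffAt ℝ n (fun y => (f y).1 i j) x)
    (i j : Fin 3) : ContDiffAt ℝ n (fun y => (A * f y).1 i j) x := by
  simp only [Submonoid.coe_mul, Matrix.mul_apply]
  exact ContDiffAt.sum fun k _ => contDiffAt_const.mul (hf k j)

theorem contDiffAt_chart_symm_entry (n : ℕ∞ω) (A : SO3) (v) (i j : Fin 3) :
    ContDiffAt ℝ n (fun w => ((chart A).symm w).1 i j) v := by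
  simp only [chart_symm_apply]
  exact contDiffAt_mul_entry A (f := fun w => ⟨cayleyMatrix w, cayleyMatrix_mem w⟩)
    (fun i j => (contDiff_cayleyMatrix n i j).contDiffAt) i j

instance (n : ℕ∞ω) : IsManifold (𝓡 3) n SO3 := by
  refine isManifold_of_contDiffOn _ _ _ ?_
  rintro _ _ ⟨A, rfl⟩ ⟨B, rfl⟩ v hv
  refine ContDiffAt.contDiffWithinAt ?_
  have hv' : (chart A).symm v ∈ (chart B).source := by
    have := hv.1
    simp at this
    exact this.2
  rw [chart_source] at hv'
  exact contDiffAt_cayleyCoord hv' (contDiffAt_mul_entry B⁻¹ (contDiffAt_chart_symm_entry n A v))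

theorem contMDiff_entry (n : ℕ∞ω) (i j : Fin 3) :
    ContMDiff (𝓡 3) 𝓘(ℝ) n fun A : SO3 => A.1 i j := by
  intro A
  rw [contMDiffAt_iff]
  refine ⟨(continuous_entry i j).continuousAt, ?_⟩
  refine ContDiffAt.contDiffWithinAt ?_
  exact contDiffAt_chart_symm_entry n A _ i j

/-- A map into `SO(3)` is smooth as soon as its matrix entries are. -/
theorem contMDiff_of_entry {E H M : Type*} [NormedAddCommGroup E] [NormedSpace ℝ E]
    [TopologicalSpace H] {I : ModelWithCorners ℝ E H} [TopologicalSpace M] [ChartedSpace H M]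
    {n : ℕ∞ω} {f : M → SO3} (hf : ∀ i j, ContMDiff I 𝓘(ℝ) n fun x => (f x).1 i j) :
    ContMDiff I (𝓡 3) n f := by
  have hc : Continuous f := by
    rw [Topology.IsInducing.subtypeVal.continuous_iff]
    exact continuous_matrix fun i j => (hf i j).continuous
  intro x
  rw [contMDiffAt_iff_target]
  refine ⟨hc.continuousAt, ?_⟩
  have hg : ∀ i j, ContMDiff I 𝓘(ℝ) n fun y => ((f x)⁻¹ * f y).1 i j := by
    intro i j
    simp only [Submonoid.coe_mul, Matrix.mul_apply]
    refine contMDiff_finsetSum fun k _ => ?_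
    exact contMDiff_const.mul (hf k j)
  have hx : 1 + ((f x)⁻¹ * f x).1.trace ≠ 0 := by
    rw [inv_mul_cancel]
    simp
    norm_num
  have ht : ContMDiffAt I 𝓘(ℝ) n (fun y => (1 + ((f x)⁻¹ * f y).1.trace)⁻¹) x := by
    refine ContMDiffAt.inv₀ ?_ hx
    simp only [Matrix.trace_fin_three]
    exact contMDiffAt_const.add (((hg 0 0).add (hg 1 1)).add (hg 2 2)).contMDiffAt
  refine ht.smul ?_
  refine ContMDiff.contMDiffAt ?_
  refine ((PiLp.continuousLinearEquiv 2 ℝ fun _ : Fin 3 => ℝ).symm.contDiff.contMDiff (n := n)).comp ?_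
  rw [contMDiff_pi_space]
  intro i
  fin_cases i <;> exact (hg _ _).sub (hg _ _)

instance (n : ℕ∞ω) : LieGroup (𝓡 3) n SO3 where
  contMDiff_mul := by
    refine contMDiff_of_entry fun i j => ?_
    simp only [Submonoid.coe_mul, Matrix.mul_apply]
    refine contMDiff_finsetSum fun k _ => ?_
    exact ((contMDiff_entry n i k).comp contMDiff_fst).mul
      ((contMDiff_entry n k j).comp contMDiff_snd)
  contMDiff_inv := by
    refine contMDiff_of_entry fun i j => ?_
    exact contMDiff_entry n j i

end SO3

namespace DiscreteQuotient

section
variable {G : Type*} [Group G] [TopologicalSpace G] [IsTopologicalGroup G]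
  (K : Subgroup G) [DiscreteTopology K]

theorem isLocalHomeomorph_mk : IsLocalHomeomorph (QuotientGroup.mk : G → G ⧸ K) :=
  (K.isQuotientCoveringMap (SetLike.isDiscrete_iff_discreteTopology.2
    inferInstance)).isCoveringMap.isLocalHomeomorph

/-- The smooth structure on `G ⧸ K`, for a discrete subgroup `K` of `G`, whose charts are the charts
of `G` composed with local sections of the covering `G → G ⧸ K`. -/
@[reducible] noncomputable def chartedSpace {E : Type*} [TopologicalSpace E] [ChartedSpace E G] :
    ChartedSpace E (G ⧸ K) :=
  (isLocalHomeomorph_mk K).chartedSpace Quotient.mk_surjective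

end

theorem isManifold {E G : Type*} [NormedAddCommGroup E] [NormedSpace ℝ E]
    [Group G] [TopologicalSpace G] [IsTopologicalGroup G] [ChartedSpace E G] (n : ℕ∞ω)
    [LieGroup 𝓘(ℝ, E) n G] (K : Subgroup G) [DiscreteTopology K] :
    let _ : ChartedSpace E (G ⧸ K) := chartedSpace K
    IsManifold 𝓘(ℝ, E) n (G ⧸ K) := by
  let _ : ChartedSpace E (G ⧸ K) := chartedSpace K
  have hl := isLocalHomeomorph_mk K
  refine isManifold_of_contDiffOn _ _ _ ?_
  rintro _ _ ⟨q₁, rfl⟩ ⟨q₂, rfl⟩ v hv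
  set x := (Quotient.mk_surjective (s := QuotientGroup.leftRel K)).hasRightInverse.choose q₁
  set y := (Quotient.mk_surjective (s := QuotientGroup.leftRel K)).hasRightInverse.choose q₂
  replace hv : v ∈ (((hl.localInverseAt x).trans (chartAt E x)).symm.trans
    ((hl.localInverseAt y).trans (chartAt E y))).source := hv.1
  simp only [OpenPartialHomeomorph.trans_source, OpenPartialHomeomorph.symm_source,
    OpenPartialHomeomorph.trans_symm_eq_symm_trans_symm, 
    OpenPartialHomeomorph.coe_trans, IsLocalHomeomorph.localInverseAt_symm,
    Set.mem_inter_iff, Set.mem_preimage, Function.comp_apply] at hv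
  obtain ⟨⟨hv1, hv2⟩, hv3, hv4⟩ := hv
  set p := (chartAt E x).symm v with hp
  set s := hl.localInverseAt y with hs
  set q := s (p : G ⧸ K) with hq
  have hpq : ((q : G) : G ⧸ K) = (p : G ⧸ K) := hl.apply_localInverseAt_of_mem hv3
  have hK : p⁻¹ * q ∈ K := QuotientGroup.eq.1 hpq.symm
  have hmul : p * (p⁻¹ * q) = q := by group
  -- near `p`, the local section composed with the projection is a right translation
  have hev : ∀ᶠ g : G in nhds p, s (g : G ⧸ K) = g * (p⁻¹ * q) := by
    have h1 : ∀ᶠ g in nhds p, g * (p⁻¹ * q) ∈ s.target := by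
      have hc : ContinuousAt (fun g : G => g * (p⁻¹ * q)) p := by fun_prop
      refine hc.eventually_mem (s.open_target.mem_nhds ?_)
      rw [hmul]
      exact s.map_source hv3
    filter_upwards [h1] with g hg
    have h2 : ((g * (p⁻¹ * q) : G) : G ⧸ K) = g := by
      rw [QuotientGroup.eq]
      simpa using K.inv_mem hK
    have h3 := s.right_inv hg
    rw [hs, IsLocalHomeomorph.localInverseAt_symm] at h3
    rw [← h2]
    exact h3
  have hR : ContMDiffAt 𝓘(ℝ, E) 𝓘(ℝ, E) n (fun g : G => g * (p⁻¹ * q)) p :=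
    (contMDiff_id.mul contMDiff_const).contMDiffAt
  have : IsManifold 𝓘(ℝ, E) n G := LieGroup.toContMDiffMul.toIsManifold
  rw [contMDiffAt_iff_of_mem_source (x := x) (y := y) ((chartAt E x).map_target hv1)
    (by rw [hmul]; exact hv4)] at hR
  have hR2 := hR.2
  simp only [extChartAt, hp] at hR2
  simp [(chartAt E x).right_inv hv1, contDiffWithinAt_univ] at hR2
  refine ContDiffAt.contDiffWithinAt ?_
  refine hR2.congr_of_eventuallyEq ?_
  have hcont : Filter.Tendsto (chartAt E x).symm (nhds v) (nhds p) :=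
    ((chartAt E x).continuousAt_symm hv1)
  filter_upwards [hcont.eventually hev] with w hw
  simp [hw, hp]

end DiscreteQuotient

/-! ### The Klein four-group in `SO(3)` and its homogeneous space -/

/-- The Klein four-group in `SO(3)`: the identity and the rotations of angle `π` around the three
coordinate axes. -/
def kleinFour : Subgroup SO3 where
  carrier := {A | A.1 = 1 ∨ A.1 = Matrix.diagonal ![1, -1, -1] ∨
    A.1 = Matrix.diagonal ![-1, 1, -1] ∨ A.1 = Matrix.diagonal ![-1, -1, 1]}
  one_mem' := Or.inl rfl
  mul_mem' := by
    rintro ⟨A, hA⟩ ⟨B, hB⟩ h1 h2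
    simp only [Set.mem_ofPred_eq, Submonoid.mk_mul_mk] at h1 h2 ⊢
    rw [← Matrix.diagonal_one] at h1 h2 ⊢
    rcases h1 with rfl | rfl | rfl | rfl <;> rcases h2 with rfl | rfl | rfl | rfl <;>
      simp [Matrix.diagonal_mul_diagonal, Matrix.diagonal_eq_diagonal_iff, Fin.forall_fin_succ,
        funext_iff]
  inv_mem' := by
    rintro ⟨A, hA⟩ h
    simp only [Set.mem_ofPred_eq, SO3.coe_inv] at h ⊢
    rcases h with rfl | rfl | rfl | rfl <;> simp

instance kleinFour_finite : Finite kleinFour := by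
  refine Set.Finite.to_subtype ?_
  refine Set.Finite.of_finite_image (f := Subtype.val) ?_ Subtype.val_injective.injOn
  refine Set.Finite.subset (s := {1, Matrix.diagonal ![1, -1, -1],
    Matrix.diagonal ![-1, 1, -1], Matrix.diagonal ![-1, -1, 1]}) (Set.toFinite _) ?_
  rintro _ ⟨A, hA, rfl⟩
  exact hA

/-- The smooth structure on `SO(3)/H`, `H` the Klein four-group, for which `SO(3) → SO(3)/H` is a
smooth covering. -/
noncomputable instance kleinQuotient_chartedSpace :
    ChartedSpace (EuclideanSpace ℝ (Fin 3)) (SO3 ⧸ kleinFour) :=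
  DiscreteQuotient.chartedSpace kleinFour

instance kleinQuotient_isManifold (n : ℕ∞ω) : IsManifold (𝓡 3) n (SO3 ⧸ kleinFour) :=
  DiscreteQuotient.isManifold n kleinFour

/-! ### The actions of `SO(3)` -/

/-- The unit sphere of `ℝ³`. -/
abbrev Sphere2 : Type := Metric.sphere (0 : EuclideanSpace ℝ (Fin 3)) 1

/-- The action of `SO(3)` on the unit sphere by matrix-vector multiplication. -/
noncomputable instance sphereAction : MulAction SO3 Sphere2 where
  smul A p := ⟨WithLp.toLp 2 (A.1 *ᵥ p.1.ofLp), by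
    have hp : p.1.ofLp ⬝ᵥ p.1.ofLp = 1 := by
      have h := p.2
      rw [mem_sphere_zero_iff_norm, EuclideanSpace.norm_eq, Real.sqrt_eq_one] at h
      simpa [dotProduct, sq] using h
    have h : (A.1 *ᵥ p.1.ofLp) ⬝ᵥ (A.1 *ᵥ p.1.ofLp) = 1 := by
      rw [Matrix.dotProduct_mulVec, Matrix.vecMul_mulVec, A.star_mul_self', Matrix.vecMul_one]
      exact hp
    rw [mem_sphere_zero_iff_norm, EuclideanSpace.norm_eq, Real.sqrt_eq_one]
    simpa [dotProduct, sq] using h⟩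
  one_smul p := Subtype.ext (by
    change WithLp.toLp 2 ((1 : Matrix (Fin 3) (Fin 3) ℝ) *ᵥ p.1.ofLp) = p.1
    rw [Matrix.one_mulVec])
  mul_smul A B p := Subtype.ext (by
    change WithLp.toLp 2 ((A.1 * B.1) *ᵥ p.1.ofLp) = WithLp.toLp 2 (A.1 *ᵥ (B.1 *ᵥ p.1.ofLp))
    rw [Matrix.mulVec_mulVec])

/-- The action of `SO(3)` on `ℝᵏ × F`, trivial on the first factor: `g • (x, y) = (x, g • y)`. -/
instance productSMul (k : ℕ) (F : Type) [SMul SO3 F] :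
    SMul SO3 (EuclideanSpace ℝ (Fin k) × F) where
  smul g p := (p.1, g • p.2)

instance productAction (k : ℕ) (F : Type) [MulAction SO3 F] :
    MulAction SO3 (EuclideanSpace ℝ (Fin k) × F) where
  one_smul p := Prod.ext rfl (one_smul SO3 p.2)
  mul_smul g h p := Prod.ext rfl (mul_smul g h p.2)

/-! ### Automorphisms of vector fields and describing vector fields -/

section VectorFields

variable {E H M : Type*} [NormedAddCommGroup E] [NormedSpace ℝ E] [TopologicalSpace H]
  (I : ModelWithCorners ℝ E H) [TopologicalSpace M] [ChartedSpace H M]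

/-- The group `Diff(M)` of smooth diffeomorphisms, under composition. -/
noncomputable instance diffeomorphGroup : Group (M ≃ₘ^∞⟮I, I⟯ M) where
  mul f g := g.trans f
  one := Diffeomorph.refl I M ∞
  inv f := f.symm
  mul_assoc _ _ _ := rfl
  one_mul _ := rfl
  mul_one _ := rfl
  inv_mul_cancel f := Diffeomorph.ext fun x => f.symm_apply_apply x

/-- The group `Aut(X)` of the diffeomorphisms `φ` with `φ_* X = X`. -/
def vectorFieldAut (X : ∀ p : M, TangentSpace I p) : Subgroup (M ≃ₘ^∞⟮I, I⟯ M) where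
  carrier := {φ | ∀ p, mfderiv I I φ p (X p) = X (φ p)}
  one_mem' p := by
    change mfderiv I I id p (X p) = X p
    rw [mfderiv_id]
    rfl
  mul_mem' := by
    intro φ ψ hφ hψ p
    change mfderiv I I (φ ∘ ψ) p (X p) = X (φ (ψ p))
    rw [mfderiv_comp p (φ.contMDiff.mdifferentiable (by simp) _)
      (ψ.contMDiff.mdifferentiable (by simp) _)]
    change mfderiv I I φ (ψ p) (mfderiv I I ψ p (X p)) = _
    rw [hψ p, hφ (ψ p)]
  inv_mem' := by
    intro φ hφ p
    obtain ⟨q, rfl⟩ := φ.surjective p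
    change (mfderiv I I φ.symm (φ q) (X (φ q)) : E) = (X (φ.symm (φ q)) : E)
    have h1 : φ.symm ∘ φ = id := funext φ.symm_apply_apply
    have h2 := mfderiv_comp q (φ.symm.contMDiff.mdifferentiable (by simp) (φ q))
      (φ.contMDiff.mdifferentiable (by simp) q)
    rw [h1, mfderiv_id] at h2
    have h3 : (X q : E) = (mfderiv I I φ.symm (φ q) (mfderiv I I φ q (X q)) : E) :=
      congrArg (fun L : E →L[ℝ] E => L (X q)) h2
    rw [hφ q] at h3
    rw [← h3]
    exact (congrArg (fun y => (X y : E)) (φ.symm_apply_apply q)).symm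

/-- `Φ` is the global flow of the vector field `X`; a vector field is complete when it has one. -/
structure IsGlobalFlow (X : ∀ p : M, TangentSpace I p) (Φ : ℝ → M → M) : Prop where
  zero : ∀ p, Φ 0 p = p
  integralCurve : ∀ p, IsMIntegralCurve (I := I) (fun t => Φ t p) X

/-- `X` is a smooth vector field on `M`. -/
def IsSmoothVectorField [IsManifold I ∞ M] (X : ∀ p : M, TangentSpace I p) : Prop :=
  ContMDiff I I.tangent ∞ fun p => (⟨p, X p⟩ : TangentBundle I M)

/-- `X` commutes with the action of `G`, that is, `g_* X = X` for every `g`. -/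
def IsInvariantVectorField (G : Type*) [Group G] [MulAction G M]
    (X : ∀ p : M, TangentSpace I p) : Prop :=
  ∀ (g : G) (p : M), mfderiv I I (fun q : M => g • q) p (X p) = X (g • p)

/-- `X` is a describing vector field for the action of `G` on `M`: it is smooth and complete, its
flow `Φ` commutes with the action, and `(g, t) ↦ g ∘ Φ t` is a group isomorphism from `G × ℝ` onto
`Aut(X)`. -/
def IsDescribingVectorField [IsManifold I ∞ M] (G : Type*) [Group G] [MulAction G M]
    (X : ∀ p : M, TangentSpace I p) : Prop :=
  IsSmoothVectorField I X ∧ ∃ Φ : ℝ → M → M, IsGlobalFlow I X Φ ∧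
    (∀ (g : G) (t : ℝ) (p : M), Φ t (g • p) = g • Φ t p) ∧
    ∃ e : G × Multiplicative ℝ ≃* vectorFieldAut I X,
      ∀ (g : G) (t : ℝ) (p : M), (e (g, Multiplicative.ofAdd t)).1 p = g • Φ t p

end VectorFields

/-- The coordinate vector field `∂/∂xⱼ` on `ℝᵏ × F`. -/
noncomputable def coordVectorField {k d : ℕ} (F : Type) [TopologicalSpace F]
    [ChartedSpace (EuclideanSpace ℝ (Fin d)) F] (j : Fin k)
    (p : EuclideanSpace ℝ (Fin k) × F) : TangentSpace ((𝓡 k).prod (𝓡 d)) p :=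
  ((EuclideanSpace.single j 1, 0) : EuclideanSpace ℝ (Fin k) × EuclideanSpace ℝ (Fin d))

/-!
# Actions of `SO(3)` without describing vector field

Both fibres `F` are homogeneous, and in both the isotropy representation at a base point `y₀` fixes
no nonzero tangent vector (`HasNoFixedTangentVector`): on the sphere the half-turn about the pole
acts as `-1`, and on `SO(3)/H` the Klein four-group `H` acts as its three half-turns on `ℝ³`. An
invariant vector field on `ℝᵏ × F` therefore has no component along `F`, and its component along
`ℝᵏ` depends on `x` only. This gives the form `∑ⱼ fⱼ(x) ∂/∂xⱼ` and the invariance under all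
`(x, y) ↦ (x, φ y)`.

If `X` is a describing vector field, then it is invariant, so for every diffeomorphism `φ` of `F`
there are `g` and `t` with `(x, φ y) = g • Φₜ(x, y)`. Since `Φₜ` commutes with the action, it drops
out on conjugation: `φ (A • y) = (g A g⁻¹) • φ y` for all rotations `A`
(`IsDescribingVectorField.exists_conj`). No integration of `X` is needed.

The contradiction comes from a twist `φ y = R(τ y) • y`, where `R(s)` is a rotation about the third
axis and `τ` is a smooth function invariant under these rotations.

* On the sphere `τ` is the height. The conjugation property at the pole forces `φ` to be the
  restriction of a linear map, which is the identity on the coordinate vectors; but `φ` is not the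
  identity.
* On `SO(3)/H` the function `τ` is a multiple of the square of the lower left entry. The
  conjugation property at the base point makes every rotation `C` conjugate to `R(τ C) C h` for some
  `h ∈ H`; the traces of these matrices disagree for a suitable `C`.
-/

/-! ### Invariant vector fields on `ℝᵏ × F` -/

section ProductAction

theorem faithfulSMul_product (k : ℕ) {F : Type} [MulAction SO3 F] [FaithfulSMul SO3 F] :
    FaithfulSMul SO3 (EuclideanSpace ℝ (Fin k) × F) where
  eq_of_smul_eq_smul h := eq_of_smul_eq_smul fun y : F => congrArg Prod.snd (h (0, y))

variable {k d : ℕ} {F : Type} [TopologicalSpace F] [ChartedSpace (EuclideanSpace ℝ (Fin d)) F]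

theorem contDiff_fst_component [IsManifold (𝓡 d) ∞ F]
    {U : ∀ p : EuclideanSpace ℝ (Fin k) × F, TangentSpace ((𝓡 k).prod (𝓡 d)) p}
    (hU : IsSmoothVectorField ((𝓡 k).prod (𝓡 d)) U) (y : F) :
    ContDiff ℝ ∞ fun x : EuclideanSpace ℝ (Fin k) =>
      (U (x, y) : EuclideanSpace ℝ (Fin k) × EuclideanSpace ℝ (Fin d)).1 := by
  have h1 : ContMDiff (𝓡 k) ((𝓡 k).prod (𝓡 d)).tangent ∞ fun x : EuclideanSpace ℝ (Fin k) =>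
      (⟨(x, y), U (x, y)⟩ : TangentBundle ((𝓡 k).prod (𝓡 d)) (EuclideanSpace ℝ (Fin k) × F)) :=
    hU.comp (contMDiff_id.prodMk contMDiff_const)
  have h2 : ContMDiff ((𝓡 k).prod (𝓡 d)) (𝓡 k) ∞
      (Prod.fst : EuclideanSpace ℝ (Fin k) × F → EuclideanSpace ℝ (Fin k)) := contMDiff_fst
  have h3 := (h2.contMDiff_tangentMap (m := ∞) (by simp)).comp h1
  refine contMDiff_vectorSpace_iff_contDiff.1 (h3.congr fun x => ?_)
  simp only [Function.comp, tangentMap_prodFst]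

variable [MulAction SO3 F]

theorem contMDiffSMul_product [h : ContMDiffSMul (𝓡 3) (𝓡 d) ∞ SO3 F] :
    ContMDiffSMul (𝓡 3) ((𝓡 k).prod (𝓡 d)) ∞ SO3 (EuclideanSpace ℝ (Fin k) × F) where
  contMDiff_smul := (contMDiff_fst.comp contMDiff_snd).prodMk
    (h.contMDiff_smul.comp (contMDiff_fst.prodMk (contMDiff_snd.comp contMDiff_snd)))

theorem mdifferentiableAt_smul [h : ContMDiffSMul (𝓡 3) (𝓡 d) ∞ SO3 F] (g : SO3) (y : F) :
    MDifferentiableAt (𝓡 d) (𝓡 d) (fun z : F => g • z) y :=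
  (h.contMDiff_smul.comp (contMDiff_const.prodMk contMDiff_id)).mdifferentiable (by simp) y

/-- The isotropy representation at `y` fixes no nonzero tangent vector. -/
def HasNoFixedTangentVector (d : ℕ) {F : Type} [TopologicalSpace F]
    [ChartedSpace (EuclideanSpace ℝ (Fin d)) F] [MulAction SO3 F] (y : F) : Prop :=
  ∀ v : EuclideanSpace ℝ (Fin d),
    (∀ g : SO3, g • y = y → mfderiv (𝓡 d) (𝓡 d) (fun z : F => g • z) y v = v) → v = 0

/-- A function `σ` intertwining `g` with a linear map `L` near a fixed point of `g` sends tangent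
vectors fixed by `g` to vectors fixed by `L`. -/
theorem map_mfderiv_eq_of_eventuallyEq [ContMDiffSMul (𝓡 3) (𝓡 d) ∞ SO3 F]
    {E' : Type*} [NormedAddCommGroup E'] [NormedSpace ℝ E'] {σ : F → E'} {y : F}
    (hσ : MDifferentiableAt (𝓡 d) 𝓘(ℝ, E') σ y) {g : SO3} (hg : g • y = y) {L : E' →L[ℝ] E'}
    (hL : (fun z => σ (g • z)) =ᶠ[nhds y] fun z => L (σ z)) {v : EuclideanSpace ℝ (Fin d)}
    (hv : mfderiv (𝓡 d) (𝓡 d) (fun z : F => g • z) y v = v) :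
    L (mfderiv (𝓡 d) 𝓘(ℝ, E') σ y v) = (mfderiv (𝓡 d) 𝓘(ℝ, E') σ y v : E') := by
  have h1 := mfderiv_comp_of_eq (I'' := 𝓘(ℝ, E')) hσ (mdifferentiableAt_smul g y) hg
  have h2 := mfderiv_comp y (L.mdifferentiableAt (x := σ y)) hσ
  have h3 : mfderiv (𝓡 d) 𝓘(ℝ, E') (σ ∘ fun z => g • z) y =
    mfderiv (𝓡 d) 𝓘(ℝ, E') (L ∘ σ) y := hL.mfderiv_eq
  rw [h1, h2, L.mfderiv_eq] at h3
  have h4 := congrArg (fun T : EuclideanSpace ℝ (Fin d) →L[ℝ] E' => T v) h3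
  rw [hg] at h4
  exact h4.symm.trans (congrArg (mfderiv (𝓡 d) 𝓘(ℝ, E') σ y) hv)

variable [ContMDiffSMul (𝓡 3) (𝓡 d) ∞ SO3 F]
  {U : ∀ p : EuclideanSpace ℝ (Fin k) × F, TangentSpace ((𝓡 k).prod (𝓡 d)) p}

theorem mfderiv_product_smul (g : SO3) (p : EuclideanSpace ℝ (Fin k) × F)
    (v : EuclideanSpace ℝ (Fin k) × EuclideanSpace ℝ (Fin d)) :
    mfderiv ((𝓡 k).prod (𝓡 d)) ((𝓡 k).prod (𝓡 d))
      (fun q : EuclideanSpace ℝ (Fin k) × F => g • q) p v =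
    (v.1, (mfderiv (𝓡 d) (𝓡 d) (fun z : F => g • z) p.2 v.2 : EuclideanSpace ℝ (Fin d))) := by
  change mfderiv ((𝓡 k).prod (𝓡 d)) ((𝓡 k).prod (𝓡 d))
    (Prod.map id (fun z : F => g • z)) p v = _
  rw [mfderiv_prodMap mdifferentiableAt_id (mdifferentiableAt_smul g p.2), mfderiv_id]
  rfl

/-- The component of an invariant vector field along `ℝᵏ` is constant on the orbits, and its
component along `F` is transported by the action. -/
theorem IsInvariantVectorField.product_apply
    (hU : IsInvariantVectorField ((𝓡 k).prod (𝓡 d)) SO3 U) (g : SO3)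
    (x : EuclideanSpace ℝ (Fin k)) (y : F) :
    (U (x, g • y) : EuclideanSpace ℝ (Fin k) × EuclideanSpace ℝ (Fin d)) =
      (((U (x, y) : EuclideanSpace ℝ (Fin k) × EuclideanSpace ℝ (Fin d))).1,
        (mfderiv (𝓡 d) (𝓡 d) (fun z : F => g • z) y
          (U (x, y) : EuclideanSpace ℝ (Fin k) × EuclideanSpace ℝ (Fin d)).2 :
            EuclideanSpace ℝ (Fin d))) := by
  exact (hU g (x, y)).symm.trans (mfderiv_product_smul g (x, y) _)

theorem IsInvariantVectorField.eq_horizontal [MulAction.IsPretransitive SO3 F] {y₀ : F}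
    (hy₀ : HasNoFixedTangentVector d y₀)
    (hU : IsInvariantVectorField ((𝓡 k).prod (𝓡 d)) SO3 U)
    (p : EuclideanSpace ℝ (Fin k) × F) :
    (U p : EuclideanSpace ℝ (Fin k) × EuclideanSpace ℝ (Fin d)) =
      ((U (p.1, y₀) : EuclideanSpace ℝ (Fin k) × EuclideanSpace ℝ (Fin d)).1, 0) := by
  obtain ⟨x, y⟩ := p
  have h0 : (U (x, y₀) : EuclideanSpace ℝ (Fin k) × EuclideanSpace ℝ (Fin d)).2 = 0 := by
    refine hy₀ _ fun g hg => ?_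
    have h := congrArg Prod.snd (hU.product_apply g x y₀)
    rw [hg] at h
    exact h.symm
  obtain ⟨g, rfl⟩ := MulAction.exists_smul_eq SO3 y₀ y
  rw [hU.product_apply g x y₀, h0]
  exact Prod.ext rfl (map_zero _)

theorem IsInvariantVectorField.exists_coeff [IsManifold (𝓡 d) ∞ F]
    [MulAction.IsPretransitive SO3 F] {y₀ : F} (hy₀ : HasNoFixedTangentVector d y₀)
    (hs : IsSmoothVectorField ((𝓡 k).prod (𝓡 d)) U)
    (hU : IsInvariantVectorField ((𝓡 k).prod (𝓡 d)) SO3 U) :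
    ∃ f : Fin k → EuclideanSpace ℝ (Fin k) → ℝ, (∀ j, ContDiff ℝ ∞ (f j)) ∧
      ∀ p, U p = ∑ j, f j p.1 • coordVectorField (d := d) F j p := by
  refine ⟨fun j x => (U (x, y₀) : EuclideanSpace ℝ (Fin k) × EuclideanSpace ℝ (Fin d)).1 j,
    fun j => (contDiff_piLp_apply (p := 2) (i := j)).comp (contDiff_fst_component hs y₀), ?_⟩
  intro p
  have h := hU.eq_horizontal hy₀ p
  set a := (U (p.1, y₀) : EuclideanSpace ℝ (Fin k) × EuclideanSpace ℝ (Fin d)).1 with ha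
  refine h.trans ?_
  change (a, 0) = ∑ j, (a j) • ((EuclideanSpace.single j 1, 0) :
    EuclideanSpace ℝ (Fin k) × EuclideanSpace ℝ (Fin d))
  refine Prod.ext ?_ ?_
  · rw [Prod.fst_sum]
    ext i
    simp [Pi.single_apply]
  · rw [Prod.snd_sum]
    simp

theorem IsInvariantVectorField.prodCongr_mem_vectorFieldAut
    [MulAction.IsPretransitive SO3 F] {y₀ : F} (hy₀ : HasNoFixedTangentVector d y₀)
    (hU : IsInvariantVectorField ((𝓡 k).prod (𝓡 d)) SO3 U) (φ : F ≃ₘ^∞⟮𝓡 d, 𝓡 d⟯ F) :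
    (Diffeomorph.refl (𝓡 k) (EuclideanSpace ℝ (Fin k)) ∞).prodCongr φ ∈
      vectorFieldAut ((𝓡 k).prod (𝓡 d)) U := by
  intro p
  change (mfderiv ((𝓡 k).prod (𝓡 d)) ((𝓡 k).prod (𝓡 d)) (Prod.map id φ) p (U p) :
    EuclideanSpace ℝ (Fin k) × EuclideanSpace ℝ (Fin d)) = U (p.1, φ p.2)
  rw [mfderiv_prodMap mdifferentiableAt_id (φ.contMDiff.mdifferentiable (by simp) _), mfderiv_id,
    hU.eq_horizontal hy₀ p, hU.eq_horizontal hy₀ (p.1, φ p.2)]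
  exact Prod.ext rfl (map_zero (mfderiv (𝓡 d) (𝓡 d) φ p.2))

/-- If `X` describes the action, each `(x, y) ↦ (x, φ y)` is some `g ∘ Φₜ`, and `Φₜ` commutes with
`SO(3)`; so conjugation by `φ` acts on `SO(3)` as conjugation by `g`. -/
theorem IsDescribingVectorField.exists_conj [IsManifold (𝓡 d) ∞ F]
    [MulAction.IsPretransitive SO3 F] {y₀ : F} (hy₀ : HasNoFixedTangentVector d y₀)
    {X : ∀ p : EuclideanSpace ℝ (Fin k) × F, TangentSpace ((𝓡 k).prod (𝓡 d)) p}
    (hX : IsDescribingVectorField ((𝓡 k).prod (𝓡 d)) SO3 X) (φ : F ≃ₘ^∞⟮𝓡 d, 𝓡 d⟯ F) :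
    ∃ g : SO3, ∀ (A : SO3) (y : F), φ (A • y) = (g * A * g⁻¹) • φ y := by
  obtain ⟨-, Φ, hΦ, hcomm, e, he⟩ := hX
  -- The diffeomorphism attached to `(g, 0)` is the action of `g`, and it preserves `X`.
  have hinv : IsInvariantVectorField ((𝓡 k).prod (𝓡 d)) SO3 X := by
    intro g p
    have h1 : ∀ q, (e (g, Multiplicative.ofAdd 0)).1 q = g • q := fun q => by
      rw [he, hΦ.zero]
    have h2 := (e (g, Multiplicative.ofAdd 0)).2 p
    have h3 : ⇑(e (g, Multiplicative.ofAdd 0)).1 =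
        fun q : EuclideanSpace ℝ (Fin k) × F => g • q := funext h1
    rw [h3] at h2
    exact h2
  obtain ⟨⟨g, t⟩, hgt⟩ := e.surjective ⟨_, hinv.prodCongr_mem_vectorFieldAut hy₀ φ⟩
  have key : ∀ y : F, ((0 : EuclideanSpace ℝ (Fin k)), φ y) = g • Φ t.toAdd (0, y) := by
    intro y
    have h := he g t.toAdd (0, y)
    rw [ofAdd_toAdd, hgt] at h
    exact h
  refine ⟨g, fun A y => ?_⟩
  have h1 : ((0 : EuclideanSpace ℝ (Fin k)), φ (A • y)) =
      (g * A * g⁻¹) • ((0 : EuclideanSpace ℝ (Fin k)), φ y) := by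
    rw [key (A • y), key y, ← mul_smul, inv_mul_cancel_right, mul_smul, ← hcomm A]
    rfl
  exact congrArg Prod.snd h1

end ProductAction

/-! ### Twists about the third axis -/

namespace SO3

/-- The rotation with diagonal matrix `ε`, for signs `ε i` with product `1`. -/
def diagonal (ε : Fin 3 → ℝ) (hsq : ∀ i, ε i * ε i = 1) (hprod : ε 0 * ε 1 * ε 2 = 1) : SO3 :=
  ⟨Matrix.diagonal ε, mem_of
    (by rw [Matrix.diagonal_transpose, Matrix.diagonal_mul_diagonal, ← Matrix.diagonal_one]
        exact congrArg _ (funext hsq))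
    (by rw [Matrix.det_diagonal, Fin.prod_univ_three, hprod])⟩

/-- The half-turn about the first coordinate axis. -/
def halfTurnFst : SO3 := diagonal ![1, -1, -1] (by simp [Fin.forall_fin_succ]) (by simp)

/-- The half-turn about the third coordinate axis. -/
def halfTurnThd : SO3 := diagonal ![-1, -1, 1] (by simp [Fin.forall_fin_succ]) (by simp)

theorem coe_halfTurnFst : halfTurnFst.1 = Matrix.diagonal ![1, -1, -1] := rfl

theorem coe_halfTurnThd : halfTurnThd.1 = Matrix.diagonal ![-1, -1, 1] := rfl

/-- The rotation about the third coordinate axis with Cayley parameter `s`, that is, of angle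
`2 arctan s`. -/
noncomputable def axialRotation (s : ℝ) : SO3 :=
  ⟨cayleyMatrix !₂[0, 0, s], cayleyMatrix_mem _⟩

theorem coe_axialRotation (s : ℝ) : (axialRotation s).1 =
    (1 + s ^ 2)⁻¹ • !![1 - s ^ 2, -(2 * s), 0; 2 * s, 1 - s ^ 2, 0; 0, 0, 1 + s ^ 2] := by
  simp [axialRotation, cayleyMatrix]

theorem axialRotation_mul_neg (s : ℝ) : axialRotation s * axialRotation (-s) = 1 := by
  have h : 1 + s ^ 2 ≠ 0 := by positivity
  apply Subtype.ext
  rw [Submonoid.coe_mul, coe_axialRotation, coe_axialRotation]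
  ext i j
  fin_cases i <;> fin_cases j <;>
    simp [Matrix.mul_apply, Fin.sum_univ_three] <;> field_simp <;> ring

theorem contMDiff_axialRotation : ContMDiff 𝓘(ℝ) (𝓡 3) ∞ axialRotation := by
  refine contMDiff_of_entry fun i j => ContDiff.contMDiff ?_
  refine (contDiff_cayleyMatrix ∞ i j).comp
    ((PiLp.contDiff_toLp (p := 2)).comp (contDiff_pi.2 fun l => ?_))
  fin_cases l
  · exact contDiff_const
  · exact contDiff_const
  · exact contDiff_id

end SO3

section Twist

variable {d : ℕ} {F : Type} [TopologicalSpace F] [ChartedSpace (EuclideanSpace ℝ (Fin d)) F]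
  [MulAction SO3 F] [h : ContMDiffSMul (𝓡 3) (𝓡 d) ∞ SO3 F]

/-- The twist `y ↦ R(τ y) • y`, where `R` is the rotation about the third axis and `τ` is invariant
under `R`. -/
noncomputable def twist (τ : F → ℝ) (hτ : ContMDiff (𝓡 d) 𝓘(ℝ) ∞ τ)
    (hinv : ∀ s y, τ (SO3.axialRotation s • y) = τ y) : F ≃ₘ^∞⟮𝓡 d, 𝓡 d⟯ F where
  toFun y := SO3.axialRotation (τ y) • y
  invFun y := SO3.axialRotation (-τ y) • y
  left_inv y := by
    have h := SO3.axialRotation_mul_neg (-τ y)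
    rw [neg_neg] at h
    simp only [hinv]
    rw [← mul_smul, h, one_smul]
  right_inv y := by
    simp only [hinv]
    rw [← mul_smul, SO3.axialRotation_mul_neg, one_smul]
  contMDiff_toFun := h.contMDiff_smul.comp
    ((SO3.contMDiff_axialRotation.comp hτ).prodMk contMDiff_id)
  contMDiff_invFun := h.contMDiff_smul.comp
    ((SO3.contMDiff_axialRotation.comp (contDiff_neg.contMDiff.comp hτ)).prodMk contMDiff_id)

theorem twist_apply {τ : F → ℝ} (hτ : ContMDiff (𝓡 d) 𝓘(ℝ) ∞ τ)
    (hinv : ∀ s y, τ (SO3.axialRotation s • y) = τ y) (y : F) :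
    twist τ hτ hinv y = SO3.axialRotation (τ y) • y := rfl

end Twist

/-! ### The sphere -/

namespace Sphere2

instance finrank_fact : Fact (Module.finrank ℝ (EuclideanSpace ℝ (Fin 3)) = 2 + 1) :=
  ⟨finrank_euclideanSpace_fin⟩

theorem smul_apply (A : SO3) (p : Sphere2) (i : Fin 3) :
    (A • p).1 i = A.1 i 0 * p.1 0 + A.1 i 1 * p.1 1 + A.1 i 2 * p.1 2 := by
  change (A.1 *ᵥ p.1.ofLp) i = _
  simp [Matrix.mulVec, dotProduct, Fin.sum_univ_three]

theorem sq_add_sq_add_sq (p : Sphere2) : p.1 0 ^ 2 + p.1 1 ^ 2 + p.1 2 ^ 2 = 1 := by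
  have h := p.2
  rw [mem_sphere_zero_iff_norm, EuclideanSpace.norm_eq, Real.sqrt_eq_one] at h
  simpa [Fin.sum_univ_three] using h

/-- The point of the sphere with given coordinates. -/
noncomputable def mk (a b c : ℝ) (h : a ^ 2 + b ^ 2 + c ^ 2 = 1) : Sphere2 :=
  ⟨!₂[a, b, c], by
    rw [mem_sphere_zero_iff_norm, EuclideanSpace.norm_eq, Real.sqrt_eq_one]
    simpa [Fin.sum_univ_three] using h⟩

theorem ext_coord {p q : Sphere2} (h0 : p.1 0 = q.1 0) (h1 : p.1 1 = q.1 1) (h2 : p.1 2 = q.1 2) :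
    p = q := by
  apply Subtype.ext
  ext i
  fin_cases i
  exacts [h0, h1, h2]

theorem contMDiff_coord (i : Fin 3) : ContMDiff (𝓡 2) 𝓘(ℝ) ∞ fun p : Sphere2 => p.1 i :=
  (EuclideanSpace.proj (𝕜 := ℝ) i).contMDiff.comp contMDiff_coe_sphere

instance : ContMDiffSMul (𝓡 3) (𝓡 2) ∞ SO3 Sphere2 where
  contMDiff_smul := by
    refine ContMDiff.codRestrict_sphere (f := fun q : SO3 × Sphere2 => (q.1 • q.2).1) ?_
      fun q => (q.1 • q.2).2
    refine ((PiLp.continuousLinearEquiv 2 ℝ fun _ : Fin 3 => ℝ).symm.contDiff.contMDiff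
      (n := ∞)).comp (g := (PiLp.continuousLinearEquiv 2 ℝ fun _ : Fin 3 => ℝ).symm)
        (f := fun q : SO3 × Sphere2 => q.1.1 *ᵥ q.2.1.ofLp) ?_
    rw [contMDiff_pi_space]
    intro i
    simp only [Matrix.mulVec, dotProduct]
    exact contMDiff_finsetSum fun j _ => ((SO3.contMDiff_entry ∞ i j).comp contMDiff_fst).mul
      ((contMDiff_coord j).comp contMDiff_snd)

instance : FaithfulSMul SO3 Sphere2 where
  eq_of_smul_eq_smul {A B} h := by
    apply Subtype.ext
    ext i j
    have h0 := congrArg (fun p : Sphere2 => p.1 i) (h (mk 1 0 0 (by norm_num)))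
    have h1 := congrArg (fun p : Sphere2 => p.1 i) (h (mk 0 1 0 (by norm_num)))
    have h2 := congrArg (fun p : Sphere2 => p.1 i) (h (mk 0 0 1 (by norm_num)))
    simp only [smul_apply] at h0 h1 h2
    simp [mk] at h0 h1 h2
    fin_cases j
    exacts [h0, h1, h2]

/-- The north pole `(0, 0, 1)`. -/
noncomputable def pole : Sphere2 := mk 0 0 1 (by norm_num)

/-- Every unit vector `p` is the image of the pole under a rotation: the rotation
in the plane through the pole and `p`, or a half-turn if `p` is the opposite pole. -/
theorem exists_smul_pole (p : Sphere2) : ∃ A : SO3, A • pole = p := by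
  have hp := sq_add_sq_add_sq p
  by_cases h : p.1 2 = -1
  · have h0 : p.1 0 = 0 := by nlinarith
    have h1 : p.1 1 = 0 := by nlinarith
    refine ⟨SO3.halfTurnFst, ?_⟩
    apply ext_coord <;> rw [smul_apply] <;>
      simp [pole, mk, SO3.coe_halfTurnFst, h0, h1, h]
  · have h' : 1 + p.1 2 ≠ 0 := fun h0 => h (by linarith)
    refine ⟨⟨SO3.cayleyMatrix !₂[-p.1 1 / (1 + p.1 2), p.1 0 / (1 + p.1 2), 0],
      SO3.cayleyMatrix_mem _⟩, ?_⟩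
    have hs : 1 + (p.1 1 / (1 + p.1 2)) ^ 2 + (p.1 0 / (1 + p.1 2)) ^ 2 = 2 / (1 + p.1 2) := by
      field_simp
      linarith
    apply ext_coord <;> rw [smul_apply] <;> simp [pole, mk, SO3.cayleyMatrix, neg_div, hs] <;>
      field_simp
    linear_combination -hp

instance : MulAction.IsPretransitive SO3 Sphere2 where
  exists_smul_eq p q := by
    obtain ⟨A, rfl⟩ := exists_smul_pole p
    obtain ⟨B, rfl⟩ := exists_smul_pole q
    exact ⟨B * A⁻¹, by rw [← mul_smul, inv_mul_cancel_right]⟩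

theorem pole_zero : pole.1 0 = 0 := rfl

theorem pole_one : pole.1 1 = 0 := rfl

theorem pole_two : pole.1 2 = 1 := rfl

theorem halfTurn_smul_pole : SO3.halfTurnThd • pole = pole := by
  apply ext_coord <;> rw [smul_apply] <;> simp [pole, mk, SO3.coe_halfTurnThd]

theorem axialRotation_smul_pole (s : ℝ) : SO3.axialRotation s • pole = pole := by
  have h : 1 + s ^ 2 ≠ 0 := by positivity
  apply ext_coord <;> rw [smul_apply, SO3.coe_axialRotation] <;> simp [pole, mk, h]

/-- The half-turn about the axis of the pole acts as `-1` on the tangent plane there. -/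
theorem hasNoFixedTangentVector_pole : HasNoFixedTangentVector 2 pole := by
  intro v hv
  have hι : MDifferentiableAt (𝓡 2) 𝓘(ℝ, EuclideanSpace ℝ (Fin 3))
      (Subtype.val : Sphere2 → EuclideanSpace ℝ (Fin 3)) pole :=
    (contMDiff_coe_sphere (m := ∞)).mdifferentiable (by simp) pole
  set w : EuclideanSpace ℝ (Fin 3) := mfderiv (𝓡 2) 𝓘(ℝ, EuclideanSpace ℝ (Fin 3))
    (Subtype.val : Sphere2 → EuclideanSpace ℝ (Fin 3)) pole v with hw
  set L : EuclideanSpace ℝ (Fin 3) →L[ℝ] EuclideanSpace ℝ (Fin 3) :=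
    Matrix.toEuclideanCLM (𝕜 := ℝ) SO3.halfTurnThd.1 with hL
  have h3 : L w = w := map_mfderiv_eq_of_eventuallyEq hι halfTurn_smul_pole
    (Filter.EventuallyEq.of_eq rfl) (hv SO3.halfTurnThd halfTurn_smul_pole)
  have hval : ∀ i, (L w) i = (SO3.halfTurnThd.1 *ᵥ w.ofLp) i := fun i => rfl
  have hw0 : w 0 = 0 := by
    have h := hval 0
    rw [h3] at h
    simp [SO3.coe_halfTurnThd, Matrix.mulVec_diagonal] at h
    linarith
  have hw1 : w 1 = 0 := by
    have h := hval 1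
    rw [h3] at h
    simp [SO3.coe_halfTurnThd, Matrix.mulVec_diagonal] at h
    linarith
  have hmv : mvfderiv (𝓡 2) (Subtype.val : Sphere2 → EuclideanSpace ℝ (Fin 3)) pole v = w := rfl
  have hw2 : w 2 = 0 := by
    have h : w ∈ (ℝ ∙ (pole : EuclideanSpace ℝ (Fin 3)))ᗮ := by
      rw [← range_mvfderiv_subtypeVal (n := 2) pole]
      exact ⟨v, hmv⟩
    rw [Submodule.mem_orthogonal_singleton_iff_inner_right] at h
    simpa [PiLp.inner_apply, Fin.sum_univ_three, hw0, hw1, pole, mk] using h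
  have hw' : w = 0 := by
    ext i
    fin_cases i
    exacts [hw0, hw1, hw2]
  refine injective_mvfderiv_subtypeVal_sphere (n := 2) pole ?_
  exact hmv.trans (hw'.trans (map_zero
    (mvfderiv (𝓡 2) (Subtype.val : Sphere2 → EuclideanSpace ℝ (Fin 3)) pole)).symm)

/-- A twist of the sphere by its height does not conjugate rotations as a rotation does. -/
theorem exists_diffeomorph_not_conj : ∃ φ : Sphere2 ≃ₘ^∞⟮𝓡 2, 𝓡 2⟯ Sphere2,
    ¬ ∃ g : SO3, ∀ (A : SO3) (y : Sphere2), φ (A • y) = (g * A * g⁻¹) • φ y := by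
  have hinv : ∀ s (y : Sphere2), (SO3.axialRotation s • y).1 2 = y.1 2 := by
    intro s y
    have h : 1 + s ^ 2 ≠ 0 := by positivity
    rw [smul_apply, SO3.coe_axialRotation]
    simp [h]
  refine ⟨twist (fun p => p.1 2) (contMDiff_coord 2) hinv, ?_⟩
  rintro ⟨g, hg⟩
  simp only [twist_apply] at hg
  -- The half-turn about the pole fixes it, so its conjugate by `g` does too:
  -- `g⁻¹ • pole` is `± pole`.
  set u := g⁻¹ • pole with hu
  have hfix : SO3.halfTurnThd • u = u := by
    have h := hg SO3.halfTurnThd pole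
    rw [halfTurn_smul_pole, axialRotation_smul_pole, mul_smul, mul_smul] at h
    rw [hu, eq_inv_smul_iff]
    exact h.symm
  have hu0 : u.1 0 = 0 := by
    have h := congrArg (fun p : Sphere2 => p.1 0) hfix
    simp only [smul_apply] at h
    simp [SO3.coe_halfTurnThd] at h
    linarith
  have hu1 : u.1 1 = 0 := by
    have h := congrArg (fun p : Sphere2 => p.1 1) hfix
    simp only [smul_apply] at h
    simp [SO3.coe_halfTurnThd] at h
    linarith
  -- Hence the twist is the restriction of the linear map `± g`.
  have key : ∀ p : Sphere2, ∀ i,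
      (SO3.axialRotation (p.1 2) • p).1 i = u.1 2 * (g • p).1 i := by
    intro p i
    obtain ⟨A, rfl⟩ := exists_smul_pole p
    rw [hg A pole, axialRotation_smul_pole, mul_smul, mul_smul, ← hu]
    simp only [smul_apply, hu0, hu1]
    simp only [pole_zero, pole_one, pole_two]
    ring
  -- This linear map fixes `(1, 0, 0)` and the pole, hence `(3 / 5, 0, 4 / 5)`, which the twist moves.
  have h1 := key (mk 1 0 0 (by norm_num)) 0
  have h2 := key pole 0
  have h3 := key (mk (3 / 5) 0 (4 / 5) (by norm_num)) 0
  rw [axialRotation_smul_pole] at h2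
  simp only [smul_apply, SO3.coe_axialRotation, pole_zero, pole_one, pole_two] at h1 h2 h3
  simp [mk] at h1 h2 h3
  norm_num at h3
  rcases h2 with h2 | h2
  · simp [h2] at h1
  · rw [h2] at h3
    linarith

end Sphere2

/-! ### The homogeneous space `SO(3)/H` as a smooth quotient -/

namespace KleinQuotient

theorem isLocalHomeomorph_mk : IsLocalHomeomorph (QuotientGroup.mk : SO3 → SO3 ⧸ kleinFour) :=
  DiscreteQuotient.isLocalHomeomorph_mk kleinFour

/-- The local section of `SO(3) → SO(3)/H` through `x`. -/
noncomputable abbrev localSection (x : SO3) : OpenPartialHomeomorph (SO3 ⧸ kleinFour) SO3 :=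
  isLocalHomeomorph_mk.localInverseAt x

theorem exists_chartAt_eq (q : SO3 ⧸ kleinFour) : ∃ x : SO3, (x : SO3 ⧸ kleinFour) = q ∧
    chartAt (EuclideanSpace ℝ (Fin 3)) q = (localSection x).trans (SO3.chart x) :=
  ⟨_, (Quotient.mk_surjective (s := QuotientGroup.leftRel kleinFour)).hasRightInverse.choose_spec q,
    rfl⟩

theorem localSection_mk {x A : SO3} (hA : A ∈ (localSection x).target) :
    localSection x (A : SO3 ⧸ kleinFour) = A := by
  have h := (localSection x).right_inv hA
  rwa [isLocalHomeomorph_mk.localInverseAt_symm] at h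

theorem mk_localSection {x : SO3} {q : SO3 ⧸ kleinFour} (hq : q ∈ (localSection x).source) :
    (localSection x q : SO3 ⧸ kleinFour) = q :=
  isLocalHomeomorph_mk.apply_localInverseAt_of_mem hq

theorem mem_localSection_source (x : SO3) : (x : SO3 ⧸ kleinFour) ∈ (localSection x).source :=
  isLocalHomeomorph_mk.apply_self_mem_localInverseAt_source

/-- If `x h` and `x` have the same image, then near `x` the local section through `x h` composed
with the projection is right translation by `h`. -/
theorem eventually_localSection_mk (x : SO3) {h : SO3} (hh : h ∈ kleinFour) :
    ∀ᶠ A : SO3 in nhds x, localSection (x * h) (A : SO3 ⧸ kleinFour) = A * h := by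
  have h1 : ∀ᶠ A : SO3 in nhds x, A * h ∈ (localSection (x * h)).target := by
    have hc : ContinuousAt (fun A : SO3 => A * h) x := by fun_prop
    exact hc.eventually_mem ((localSection (x * h)).open_target.mem_nhds
      isLocalHomeomorph_mk.self_mem_localInverseAt_target)
  filter_upwards [h1] with A hA
  have h2 : ((A * h : SO3) : SO3 ⧸ kleinFour) = A := by
    rw [QuotientGroup.eq]
    simpa using kleinFour.inv_mem hh
  rw [← h2]
  exact localSection_mk hA

theorem contMDiff_mul_right (h : SO3) : ContMDiff (𝓡 3) (𝓡 3) ∞ fun A : SO3 => A * h :=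
  contMDiff_id.mul contMDiff_const

theorem contMDiff_mk :
    ContMDiff (𝓡 3) (𝓡 3) ∞ (QuotientGroup.mk : SO3 → SO3 ⧸ kleinFour) := by
  intro x
  rw [contMDiffAt_iff_target]
  refine ⟨isLocalHomeomorph_mk.continuous.continuousAt, ?_⟩
  obtain ⟨y, hy, hc⟩ := exists_chartAt_eq (x : SO3 ⧸ kleinFour)
  have hh : x⁻¹ * y ∈ kleinFour := QuotientGroup.eq.1 hy.symm
  have hxy : x * (x⁻¹ * y) = y := mul_inv_cancel_left x y
  have h1 : ContMDiffAt (𝓡 3) 𝓘(ℝ, EuclideanSpace ℝ (Fin 3)) ∞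
      (fun A : SO3 => extChartAt (𝓡 3) y (A * (x⁻¹ * y))) x := by
    refine ContMDiffAt.comp x (g := extChartAt (𝓡 3) y) ?_ (contMDiff_mul_right _ x)
    rw [hxy]
    exact contMDiffAt_extChartAt
  refine h1.congr_of_eventuallyEq ?_
  have h2 := eventually_localSection_mk x hh
  rw [hxy] at h2
  filter_upwards [h2] with A hA
  simp only [Function.comp, extChartAt, hc]
  change SO3.chart y (localSection y A) = SO3.chart y (A * (x⁻¹ * y))
  rw [hA]

theorem contMDiffAt_localSection (x : SO3) :
    ContMDiffAt (𝓡 3) (𝓡 3) ∞ (localSection x) (x : SO3 ⧸ kleinFour) := by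
  rw [contMDiffAt_iff_source]
  obtain ⟨y, hy, hc⟩ := exists_chartAt_eq (x : SO3 ⧸ kleinFour)
  have hh : y⁻¹ * x ∈ kleinFour := QuotientGroup.eq.1 hy
  have hxy : y * (y⁻¹ * x) = x := mul_inv_cancel_left y x
  have hbase : extChartAt (𝓡 3) (x : SO3 ⧸ kleinFour) (x : SO3 ⧸ kleinFour) =
      extChartAt (𝓡 3) y y := by
    simp only [extChartAt, hc]
    change SO3.chart y (localSection y (x : SO3 ⧸ kleinFour)) = SO3.chart y y
    rw [← hy, localSection_mk isLocalHomeomorph_mk.self_mem_localInverseAt_target]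
  have hs : ContMDiffAt 𝓘(ℝ, EuclideanSpace ℝ (Fin 3)) (𝓡 3) ∞ (extChartAt (𝓡 3) y).symm
      (extChartAt (𝓡 3) y y) :=
    (contMDiffOn_extChartAt_symm y).contMDiffAt (extChartAt_target_mem_nhds y)
  rw [hbase]
  refine ContMDiffAt.contMDiffWithinAt ?_
  refine ((contMDiff_mul_right (y⁻¹ * x)).contMDiffAt.comp _ hs).congr_of_eventuallyEq ?_
  have h2 := eventually_localSection_mk y hh
  rw [hxy] at h2
  have ht : Filter.Tendsto (extChartAt (𝓡 3) y).symm (nhds (extChartAt (𝓡 3) y y)) (nhds y) := by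
    have := hs.continuousAt.tendsto
    rwa [extChartAt_to_inv] at this
  filter_upwards [ht.eventually h2] with v hv
  refine Eq.trans ?_ hv
  simp only [Function.comp, extChartAt, hc]
  refine congrArg (localSection x) ?_
  change (localSection y).symm ((SO3.chart y).symm v) = _
  rw [isLocalHomeomorph_mk.localInverseAt_symm]
  rfl

/-- A function on `SO(3)/H` is smooth as soon as its pullback to `SO(3)` is. -/
theorem contMDiff_of_comp_mk {E H M : Type*} [NormedAddCommGroup E] [NormedSpace ℝ E]
    [TopologicalSpace H] {I : ModelWithCorners ℝ E H} [TopologicalSpace M] [ChartedSpace H M]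
    {f : SO3 ⧸ kleinFour → M} (hf : ContMDiff (𝓡 3) I ∞ fun A : SO3 => f A) :
    ContMDiff (𝓡 3) I ∞ f := by
  intro q
  obtain ⟨x, rfl⟩ := QuotientGroup.mk_surjective q
  refine ((hf.contMDiffAt).comp _ (contMDiffAt_localSection x)).congr_of_eventuallyEq ?_
  filter_upwards [(localSection x).open_source.mem_nhds (mem_localSection_source x)] with q hq
  exact congrArg f (mk_localSection hq).symm

instance : ContMDiffSMul (𝓡 3) (𝓡 3) ∞ SO3 (SO3 ⧸ kleinFour) where
  contMDiff_smul := by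
    rintro ⟨g, q⟩
    obtain ⟨x, rfl⟩ := QuotientGroup.mk_surjective q
    have h1 : ContMDiffAt ((𝓡 3).prod (𝓡 3)) (𝓡 3) ∞
        (fun p : SO3 × (SO3 ⧸ kleinFour) => localSection x p.2) (g, (x : SO3 ⧸ kleinFour)) :=
      ContMDiffAt.comp (g, (x : SO3 ⧸ kleinFour)) (contMDiffAt_localSection x) contMDiffAt_snd
    refine (contMDiff_mk.contMDiffAt.comp _ (contMDiffAt_fst.mul h1)).congr_of_eventuallyEq ?_
    have h2 : ∀ᶠ p : SO3 × (SO3 ⧸ kleinFour) in nhds (g, (x : SO3 ⧸ kleinFour)),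
        p.2 ∈ (localSection x).source :=
      continuousAt_snd.eventually_mem
        ((localSection x).open_source.mem_nhds (mem_localSection_source x))
    filter_upwards [h2] with p hp
    conv_lhs => rw [← mk_localSection hp]
    rfl

end KleinQuotient

/-! ### Isotropy and twists of `SO(3)/H` -/

namespace KleinQuotient

theorem exists_diagonal_of_mem {h : SO3} (hh : h ∈ kleinFour) : ∃ ε : Fin 3 → ℝ,
    h.1 = Matrix.diagonal ε ∧ (∀ i, ε i * ε i = 1) ∧ ε 0 * ε 1 * ε 2 = 1 := by
  rcases hh with hh | hh | hh | hh
  · exact ⟨fun _ => 1, by rw [hh, Matrix.diagonal_one], by simp, by simp⟩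
  · exact ⟨_, hh, by simp [Fin.forall_fin_succ], by simp⟩
  · exact ⟨_, hh, by simp [Fin.forall_fin_succ], by simp⟩
  · exact ⟨_, hh, by simp [Fin.forall_fin_succ], by simp⟩

/-- The vector of Cayley parameters is the axis of the rotation, so conjugation by a diagonal
rotation `h` transforms it by `h`. -/
theorem cayleyCoord_conj {h : SO3} (hh : h ∈ kleinFour) (A : SO3) :
    SO3.cayleyCoord (h * A * h⁻¹) = Matrix.toEuclideanCLM (𝕜 := ℝ) h.1 (SO3.cayleyCoord A) := by
  obtain ⟨ε, hε, hsq, hprod⟩ := exists_diagonal_of_mem hh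
  have hent : ∀ i j, (h * A * h⁻¹).1 i j = ε i * A.1 i j * ε j := by
    intro i j
    rw [Submonoid.coe_mul, Submonoid.coe_mul, SO3.coe_inv, hε, Matrix.diagonal_transpose,
      Matrix.mul_diagonal, Matrix.diagonal_mul]
  have h0 : ε 2 * ε 1 = ε 0 := by linear_combination ε 0 * hprod - ε 1 * ε 2 * hsq 0
  have h1 : ε 0 * ε 2 = ε 1 := by linear_combination ε 1 * hprod - ε 0 * ε 2 * hsq 1
  have h2 : ε 1 * ε 0 = ε 2 := by linear_combination ε 2 * hprod - ε 0 * ε 1 * hsq 2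
  have htr : (h * A * h⁻¹).1.trace = A.1.trace := by
    rw [Matrix.trace_fin_three, Matrix.trace_fin_three, hent, hent, hent]
    linear_combination A.1 0 0 * hsq 0 + A.1 1 1 * hsq 1 + A.1 2 2 * hsq 2
  ext i
  change _ = (h.1 *ᵥ (SO3.cayleyCoord A).ofLp) i
  rw [hε, Matrix.mulVec_diagonal]
  simp only [SO3.cayleyCoord, htr, hent]
  fin_cases i
  · simp
    linear_combination (1 + A.1.trace)⁻¹ * (A.1 2 1 - A.1 1 2) * h0
  · simp
    linear_combination (1 + A.1.trace)⁻¹ * (A.1 0 2 - A.1 2 0) * h1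
  · simp
    linear_combination (1 + A.1.trace)⁻¹ * (A.1 1 0 - A.1 0 1) * h2

theorem commute_of_mem {x h : SO3} (hx : x ∈ kleinFour) (hh : h ∈ kleinFour) : h * x = x * h := by
  obtain ⟨ε, hε, -⟩ := exists_diagonal_of_mem hx
  obtain ⟨δ, hδ, -⟩ := exists_diagonal_of_mem hh
  apply Subtype.ext
  rw [Submonoid.coe_mul, Submonoid.coe_mul, hε, hδ, Matrix.diagonal_mul_diagonal,
    Matrix.diagonal_mul_diagonal]
  simp only [mul_comm]

theorem smul_mk_one {h : SO3} (hh : h ∈ kleinFour) :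
    h • ((1 : SO3) : SO3 ⧸ kleinFour) = ((1 : SO3) : SO3 ⧸ kleinFour) := by
  change ((h * 1 : SO3) : SO3 ⧸ kleinFour) = _
  rw [QuotientGroup.eq]
  simpa using hh

/-- In the Cayley chart at the base point, `h ∈ H` acts linearly, by the matrix `h`. -/
theorem eventually_extChartAt_smul {h : SO3} (hh : h ∈ kleinFour) :
    (fun q => extChartAt (𝓡 3) ((1 : SO3) : SO3 ⧸ kleinFour) (h • q))
      =ᶠ[nhds ((1 : SO3) : SO3 ⧸ kleinFour)] fun q =>
        Matrix.toEuclideanCLM (𝕜 := ℝ) h.1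
          (extChartAt (𝓡 3) ((1 : SO3) : SO3 ⧸ kleinFour) q) := by
  obtain ⟨x, hx, hc⟩ := exists_chartAt_eq ((1 : SO3) : SO3 ⧸ kleinFour)
  have hxK : x ∈ kleinFour := by simpa using QuotientGroup.eq.1 hx.symm
  have hconj : h * x * h⁻¹ = x := by rw [commute_of_mem hxK hh, mul_inv_cancel_right]
  have hsrc := mem_localSection_source x
  have hval : localSection x (x : SO3 ⧸ kleinFour) = x :=
    localSection_mk isLocalHomeomorph_mk.self_mem_localInverseAt_target
  have h1 : ∀ᶠ q in nhds (x : SO3 ⧸ kleinFour),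
      h * localSection x q * h⁻¹ ∈ (localSection x).target := by
    have hcont : ContinuousAt (fun q => h * localSection x q * h⁻¹) (x : SO3 ⧸ kleinFour) :=
      (continuousAt_const.mul ((localSection x).continuousAt hsrc)).mul continuousAt_const
    refine hcont.eventually_mem ((localSection x).open_target.mem_nhds ?_)
    rw [hval, hconj]
    exact isLocalHomeomorph_mk.self_mem_localInverseAt_target
  rw [← hx] at hc ⊢
  filter_upwards [h1, (localSection x).open_source.mem_nhds hsrc] with q hq hqs
  simp only [extChartAt, hc]
  change SO3.cayleyCoord (x⁻¹ * localSection x (h • q)) =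
    Matrix.toEuclideanCLM (𝕜 := ℝ) h.1 (SO3.cayleyCoord (x⁻¹ * localSection x q))
  have hq' : h • q = ((h * localSection x q * h⁻¹ : SO3) : SO3 ⧸ kleinFour) := by
    conv_lhs => rw [← mk_localSection hqs]
    change ((h * localSection x q : SO3) : SO3 ⧸ kleinFour) = _
    rw [QuotientGroup.eq]
    simpa [mul_assoc] using hh
  rw [hq', localSection_mk hq, ← cayleyCoord_conj hh]
  congr 1
  have hcomm := commute_of_mem (kleinFour.inv_mem hxK) hh
  simp only [← mul_assoc, hcomm]

theorem halfTurnFst_mem : SO3.halfTurnFst ∈ kleinFour := Or.inr (Or.inl rfl)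

theorem halfTurnThd_mem : SO3.halfTurnThd ∈ kleinFour := Or.inr (Or.inr (Or.inr rfl))

/-- The isotropy representation at the base point is the restriction to `H` of the standard
representation on `ℝ³`. -/
theorem hasNoFixedTangentVector_mk_one :
    HasNoFixedTangentVector 3 ((1 : SO3) : SO3 ⧸ kleinFour) := by
  intro v hv
  set q : SO3 ⧸ kleinFour := ((1 : SO3) : SO3 ⧸ kleinFour) with hq
  have hσ : MDifferentiableAt (𝓡 3) 𝓘(ℝ, EuclideanSpace ℝ (Fin 3)) (extChartAt (𝓡 3) q) q :=
    (contMDiffAt_extChartAt (n := ∞)).mdifferentiableAt (by simp)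
  set w : EuclideanSpace ℝ (Fin 3) :=
    mfderiv (𝓡 3) 𝓘(ℝ, EuclideanSpace ℝ (Fin 3)) (extChartAt (𝓡 3) q) q v with hw
  have hL : ∀ h ∈ kleinFour, h.1 *ᵥ w.ofLp = w.ofLp := fun h hh =>
    congrArg WithLp.ofLp (map_mfderiv_eq_of_eventuallyEq hσ (smul_mk_one hh)
      (eventually_extChartAt_smul hh) (hv h (smul_mk_one hh)))
  have h0 := congrFun (hL _ halfTurnThd_mem) 0
  have h1 := congrFun (hL _ halfTurnThd_mem) 1
  have h2 := congrFun (hL _ halfTurnFst_mem) 2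
  simp [SO3.coe_halfTurnFst, SO3.coe_halfTurnThd, Matrix.mulVec_diagonal] at h0 h1 h2
  have hw' : w = 0 := by
    ext i
    fin_cases i
    · change w 0 = 0
      linarith
    · change w 1 = 0
      linarith
    · change w 2 = 0
      linarith
  have hinj := (isInvertible_mfderiv_extChartAt (I := 𝓡 3) (mem_extChartAt_source q)).injective
  refine hinj ?_
  exact hw'.trans (map_zero
    (mfderiv (𝓡 3) 𝓘(ℝ, EuclideanSpace ℝ (Fin 3)) (extChartAt (𝓡 3) q) q)).symm

/-- The rotation of angle `π / 3` about the direction `(1, 1, 1)`. -/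
noncomputable def diagonalRotation : SO3 :=
  ⟨!![2 / 3, -1 / 3, 2 / 3; 2 / 3, 2 / 3, -1 / 3; -1 / 3, 2 / 3, 2 / 3], SO3.mem_of
    (by
      ext i j
      fin_cases i <;> fin_cases j <;> simp [Matrix.mul_apply, Fin.sum_univ_three] <;> norm_num)
    (by
      simp [Matrix.det_fin_three]
      norm_num)⟩

theorem coe_diagonalRotation : diagonalRotation.1 =
    !![2 / 3, -1 / 3, 2 / 3; 2 / 3, 2 / 3, -1 / 3; -1 / 3, 2 / 3, 2 / 3] := rfl

/-- The conjugate of `H` by `diagonalRotation` meets `H` trivially. -/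
theorem eq_one_of_conj_mem {g : SO3} (hg : g ∈ kleinFour)
    (hg' : diagonalRotation⁻¹ * g * diagonalRotation ∈ kleinFour) : g = 1 := by
  obtain ⟨ε, hε, hsq, hprod⟩ := exists_diagonal_of_mem hg
  obtain ⟨δ, hδ, -, -⟩ := exists_diagonal_of_mem hg'
  rw [Submonoid.coe_mul, Submonoid.coe_mul, SO3.coe_inv, hε] at hδ
  have h := congrFun (congrFun hδ 0) 1
  simp [Matrix.mul_apply, Fin.sum_univ_three, coe_diagonalRotation] at h
  have hcases : ∀ i, ε i = 1 ∨ ε i = -1 := fun i => mul_self_eq_one_iff.1 (hsq i)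
  have hall : ∀ i, ε i = 1 := by
    rcases hcases 0 with a | a <;> rcases hcases 1 with b | b <;> rcases hcases 2 with c | c <;>
      rw [a, b, c] at h hprod <;>
      first
        | (exfalso; norm_num at h; done)
        | (exfalso; norm_num at hprod; done)
        | simp [Fin.forall_fin_succ, a, b, c]
  apply Subtype.ext
  rw [hε, funext hall]
  exact Matrix.diagonal_one

instance : FaithfulSMul SO3 (SO3 ⧸ kleinFour) where
  eq_of_smul_eq_smul {a b} h := by
    have hconj : ∀ x : SO3, x⁻¹ * (b⁻¹ * a) * x ∈ kleinFour := by
      intro x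
      have h1 : ((b * x : SO3) : SO3 ⧸ kleinFour) = ((a * x : SO3) : SO3 ⧸ kleinFour) :=
        (h (x : SO3 ⧸ kleinFour)).symm
      rw [QuotientGroup.eq] at h1
      simpa [mul_assoc] using h1
    have h1 := eq_one_of_conj_mem (by simpa using hconj 1) (hconj diagonalRotation)
    exact (inv_mul_eq_one.1 h1).symm

/-- Nine times the square of the lower left entry of a rotation, as a function on `SO(3)/H`. The
factor makes the value at `diagonalRotation` equal to `1`, the Cayley parameter of a quarter turn. -/
noncomputable def cornerSq (q : SO3 ⧸ kleinFour) : ℝ :=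
  Quotient.liftOn' q (fun A : SO3 => 9 * A.1 2 0 ^ 2) (by
    intro A B hAB
    rw [QuotientGroup.leftRel_apply] at hAB
    obtain ⟨ε, hε, hsq, -⟩ := exists_diagonal_of_mem hAB
    have h1 : B.1 = A.1 * Matrix.diagonal ε := by
      rw [← hε, ← Submonoid.coe_mul, mul_inv_cancel_left]
    simp only [h1, Matrix.mul_diagonal]
    linear_combination -9 * A.1 2 0 ^ 2 * hsq 0)

theorem cornerSq_mk (A : SO3) : cornerSq (A : SO3 ⧸ kleinFour) = 9 * A.1 2 0 ^ 2 := rfl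

theorem contMDiff_cornerSq : ContMDiff (𝓡 3) 𝓘(ℝ) ∞ cornerSq :=
  contMDiff_of_comp_mk (contMDiff_const.mul ((SO3.contMDiff_entry ∞ 2 0).pow 2))

/-- A twist of `SO(3)/H` does not conjugate the action of rotations as a rotation does: evaluated at
the base point, this would make a rotation `C` conjugate to `R C h` for some `h ∈ H`, where `R` is
a quarter turn, and their traces differ. -/
theorem exists_diffeomorph_not_conj :
    ∃ φ : (SO3 ⧸ kleinFour) ≃ₘ^∞⟮𝓡 3, 𝓡 3⟯ (SO3 ⧸ kleinFour),
      ¬ ∃ g : SO3, ∀ (A : SO3) (y : SO3 ⧸ kleinFour), φ (A • y) = (g * A * g⁻¹) • φ y := by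
  have hinv : ∀ s (y : SO3 ⧸ kleinFour), cornerSq (SO3.axialRotation s • y) = cornerSq y := by
    intro s y
    obtain ⟨A, rfl⟩ := QuotientGroup.mk_surjective y
    have h : 1 + s ^ 2 ≠ 0 := by positivity
    change cornerSq ((SO3.axialRotation s * A : SO3) : SO3 ⧸ kleinFour) = _
    rw [cornerSq_mk, cornerSq_mk, Submonoid.coe_mul, SO3.coe_axialRotation]
    simp [Matrix.mul_apply, Fin.sum_univ_three, h]
  refine ⟨twist cornerSq contMDiff_cornerSq hinv, ?_⟩
  rintro ⟨g, hg⟩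
  set C := diagonalRotation with hC
  have h1 := hg C ((1 : SO3) : SO3 ⧸ kleinFour)
  have hCs : C • ((1 : SO3) : SO3 ⧸ kleinFour) = (C : SO3 ⧸ kleinFour) :=
    congrArg QuotientGroup.mk (mul_one C)
  have hτC : cornerSq (C : SO3 ⧸ kleinFour) = 1 := by
    rw [cornerSq_mk, hC, coe_diagonalRotation]
    simp
    norm_num
  have hτ1 : cornerSq ((1 : SO3) : SO3 ⧸ kleinFour) = 0 := by
    rw [cornerSq_mk]
    simp
  have hR0 : SO3.axialRotation 0 = 1 := by
    apply Subtype.ext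
    rw [SO3.coe_axialRotation]
    ext i j
    fin_cases i <;> fin_cases j <;> simp
  rw [twist_apply, twist_apply, hCs, hτC, hτ1, hR0, one_smul] at h1
  have h2 : (SO3.axialRotation 1 * C)⁻¹ * (g * C * g⁻¹) ∈ kleinFour := by
    rw [← QuotientGroup.eq]
    refine h1.trans ?_
    exact congrArg QuotientGroup.mk (mul_one _)
  obtain ⟨ε, hε, hsq, -⟩ := exists_diagonal_of_mem h2
  have h3 : (g * C * g⁻¹).1 = (SO3.axialRotation 1).1 * C.1 * Matrix.diagonal ε := by
    rw [← hε, ← Submonoid.coe_mul, ← Submonoid.coe_mul, mul_inv_cancel_left]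
  have h4 : (g * C * g⁻¹).1.trace = C.1.trace := by
    rw [Submonoid.coe_mul, Matrix.trace_mul_comm, ← Submonoid.coe_mul, inv_mul_cancel_left]
  rw [h3, SO3.coe_axialRotation, hC, coe_diagonalRotation, Matrix.trace_fin_three,
    Matrix.trace_fin_three] at h4
  simp [Matrix.mul_apply, Fin.sum_univ_three] at h4
  norm_num at h4
  have hcases : ∀ i, ε i = 1 ∨ ε i = -1 := fun i => mul_self_eq_one_iff.1 (hsq i)
  rcases hcases 0 with a | a <;> rcases hcases 1 with b | b <;> rcases hcases 2 with c | c <;>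
    rw [a, b, c] at h4 <;> norm_num at h4

end KleinQuotient

/-! ### The theorem -/

theorem mainTheorem2 (k : ℕ) (hk : 1 ≤ k) :
    -- the action of `SO(3)` on `ℝᵏ × SO(3)/H`
    (ContMDiffSMul (𝓡 3) ((𝓡 k).prod (𝓡 3)) ∞ SO3
        (EuclideanSpace ℝ (Fin k) × (SO3 ⧸ kleinFour)) ∧
      FaithfulSMul SO3 (EuclideanSpace ℝ (Fin k) × (SO3 ⧸ kleinFour)) ∧
      (¬ ∃ X : ∀ p : EuclideanSpace ℝ (Fin k) × (SO3 ⧸ kleinFour),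
          TangentSpace ((𝓡 k).prod (𝓡 3)) p,
        IsDescribingVectorField ((𝓡 k).prod (𝓡 3)) SO3 X) ∧
      ∀ U : ∀ p : EuclideanSpace ℝ (Fin k) × (SO3 ⧸ kleinFour),
          TangentSpace ((𝓡 k).prod (𝓡 3)) p,
        IsSmoothVectorField ((𝓡 k).prod (𝓡 3)) U →
        IsInvariantVectorField ((𝓡 k).prod (𝓡 3)) SO3 U →
        (∃ f : Fin k → EuclideanSpace ℝ (Fin k) → ℝ, (∀ j, ContDiff ℝ ∞ (f j)) ∧
          ∀ p, U p = ∑ j, f j p.1 • coordVectorField (d := 3) (SO3 ⧸ kleinFour) j p) ∧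
        ∀ φ : (SO3 ⧸ kleinFour) ≃ₘ^∞⟮𝓡 3, 𝓡 3⟯ (SO3 ⧸ kleinFour),
          (Diffeomorph.refl (𝓡 k) (EuclideanSpace ℝ (Fin k)) ∞).prodCongr φ ∈
            vectorFieldAut ((𝓡 k).prod (𝓡 3)) U) ∧
    -- the action of `SO(3)` on `ℝᵏ × S²`
    (ContMDiffSMul (𝓡 3) ((𝓡 k).prod (𝓡 2)) ∞ SO3 (EuclideanSpace ℝ (Fin k) × Sphere2) ∧
      FaithfulSMul SO3 (EuclideanSpace ℝ (Fin k) × Sphere2) ∧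
      (¬ ∃ X : ∀ p : EuclideanSpace ℝ (Fin k) × Sphere2, TangentSpace ((𝓡 k).prod (𝓡 2)) p,
        IsDescribingVectorField ((𝓡 k).prod (𝓡 2)) SO3 X) ∧
      ∀ U : ∀ p : EuclideanSpace ℝ (Fin k) × Sphere2, TangentSpace ((𝓡 k).prod (𝓡 2)) p,
        IsSmoothVectorField ((𝓡 k).prod (𝓡 2)) U →
        IsInvariantVectorField ((𝓡 k).prod (𝓡 2)) SO3 U →
        (∃ f : Fin k → EuclideanSpace ℝ (Fin k) → ℝ, (∀ j, ContDiff ℝ ∞ (f j)) ∧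
          ∀ p, U p = ∑ j, f j p.1 • coordVectorField (d := 2) Sphere2 j p) ∧
        ∀ φ : Sphere2 ≃ₘ^∞⟮𝓡 2, 𝓡 2⟯ Sphere2,
          (Diffeomorph.refl (𝓡 k) (EuclideanSpace ℝ (Fin k)) ∞).prodCongr φ ∈
            vectorFieldAut ((𝓡 k).prod (𝓡 2)) U) := by
  refine ⟨⟨contMDiffSMul_product, faithfulSMul_product k, ?_, fun U hs hU => ?_⟩,
    ⟨contMDiffSMul_product, faithfulSMul_product k, ?_, fun U hs hU => ?_⟩⟩
  · rintro ⟨X, hX⟩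
    obtain ⟨φ, hφ⟩ := KleinQuotient.exists_diffeomorph_not_conj
    exact hφ (hX.exists_conj KleinQuotient.hasNoFixedTangentVector_mk_one φ)
  · exact ⟨hU.exists_coeff KleinQuotient.hasNoFixedTangentVector_mk_one hs,
      hU.prodCongr_mem_vectorFieldAut KleinQuotient.hasNoFixedTangentVector_mk_one⟩
  · rintro ⟨X, hX⟩
    obtain ⟨φ, hφ⟩ := Sphere2.exists_diffeomorph_not_conj
    exact hφ (hX.exists_conj Sphere2.hasNoFixedTangentVector_pole φ)
  · exact ⟨hU.exists_coeff Sphere2.hasNoFixedTangentVector_pole hs,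
      hU.prodCongr_mem_vectorFieldAut Sphere2.hasNoFixedTangentVector_pole⟩
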